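/- An algebraic point with conjugate coordinates is a point $\boldsymbol\alpha=(\alpha_1,\alpha_2)\in\mathbb R^2$ whose coordinates are algebraic numbers conjugate over $\mathbb Q$. Its minimal polynomial is the polynomial $P\in\mathbb Z[t]$ of smallest degree, with coprime coefficients, such that $P(\alpha_1)=P(\alpha_2)=0$ (unique up to sign); the degree of $\boldsymbol\alpha$ is $\deg P$, and its height is the maximum of the absolute values of the coefficients of $P$. For $n\in\mathbb N$ and real $Q$, let $\mathbb A_n^2(Q,\Pi)$ be the set of algebraic points with conjugate coordinates, of degree at most $n$ and height at most $Q$, that lie in $\Pi\subset\mathbb R^2$. Let $\mu_1,\mu_2$ be Lebesgue measure on $\mathbb R$ and $\mathbb R^2$. **Theorem 1.** Let $n\ge 2$, $\varepsilon>0$ and $\mathbf d=(d_1,d_2)\in\mathbb R^2$. There are constants $c_0=c_0(n,\varepsilon,\mathbf d)>0$ and $c_2=c_2(n,\varepsilon,\mathbf d)>0$ such that the following holds. Let $\mathbf s=(s_1,s_2)$ be real numbers with $s_1,s_2<1$ and $0<s_1+s_2\le 1$, and let $\kappa>0$, where $\kappa\ge c_0$ if $s_1+s_2=1$. Then there is $Q_0=Q_0(n,\varepsilon,\mathbf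 d,\mathbf s,\kappa)>0$ such that for all $c_{1,1},c_{1,2}>0$ with $c_{1,1}c_{1,2}>\kappa$, all real $Q>Q_0$ and every rectangle $\Pi=I_1\times I_2$ ($I_1,I_2$ bounded intervals, open, closed or half-open) with midpoint $\mathbf d$ such that 1. $\mu_1I_i=c_{1,i}Q^{-s_i}$ for $i=1,2$, and 2. $\Pi\cap\{(x_1,x_2)\in\mathbb R^2:\ |x_1-x_2|<\varepsilon\}=\emptyset$, one has $$\#\mathbb A_n^2(Q,\Pi)\ \ge\ c_2\,Q^{n+1}\,\mu_2\Pi .$$ In particular, if $s_1+s_2=1$, one may take $\kappa=c_0$: the condition on the side lengths is then $c_{1,1}c_{1,2}>c_0$, and $Q_0$ depends only on $n,\varepsilon,\mathbf d,\mathbf s$. -/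

import Mathlib

open Polynomial MeasureTheory

/-- The height `H(P)` of an integer polynomial: the largest absolute value of its coefficients. -/
def polyHeight (P : ℤ[X]) : ℕ :=
  P.support.sup fun j => (P.coeff j).natAbs

/-- `α₁` and `α₂` are both roots of `P`. -/
def HasRoots (P : ℤ[X]) (α₁ α₂ : ℝ) : Prop :=
  aeval α₁ P = 0 ∧ aeval α₂ P = 0

/-- `P` is a minimal polynomial of the point `(α₁, α₂)`: an integer polynomial with coprime
coefficients that vanishes at both coordinates, of the smallest degree among such polynomials. -/
def IsMinimalPolynomial (P : ℤ[X]) (α₁ α₂ : ℝ) : Prop :=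
  P.IsPrimitive ∧ HasRoots P α₁ α₂ ∧
    ∀ R : ℤ[X], R.IsPrimitive → HasRoots R α₁ α₂ → P.natDegree ≤ R.natDegree

/-- The algebraic points `(α₁, α₂)` in the plane, with coordinates conjugate over `ℚ`, whose
minimal polynomial has degree at most `n` and height at most `Q`. -/
def algebraicPoints (n : ℕ) (Q : ℝ) : Set (ℝ × ℝ) :=
  {α | IsConjRoot ℚ α.1 α.2 ∧
    ∃ P : ℤ[X], IsMinimalPolynomial P α.1 α.2 ∧ P.natDegree ≤ n ∧ (polyHeight P : ℝ) ≤ Q}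

/-- `I` is a bounded nondegenerate interval (open, closed or half-open) with midpoint `m`. -/
def IsIntervalWithMidpoint (I : Set ℝ) (m : ℝ) : Prop :=
  ∃ r : ℝ, 0 < r ∧ Set.Ioo (m - r) (m + r) ⊆ I ∧ I ⊆ Set.Icc (m - r) (m + r)

/-! Let r₁ ≤ r₂ be the half-sides (the other order follows by swapping coordinates). The points come
from integer polynomials P = (y - d₁)(y - d₂)G + B(y - d₁) + E of degree n, with G bounded below by
a multiple of Q near d₁ and d₂, |B| at most a small multiple of Q r₂, and |E| at most a small
multiple of Q r₁. Sign changes give a root within r₁ of d₁ and one within r₂ of d₂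
(`exists_roots_near`); the larger B is harmless near d₁ because there it is multiplied by y - d₁.

The n - 1 coefficients of degree at least 2 are chosen freely on the scale Q. They leave a real
linear remainder modulo (y - d₁)(y - d₂), which the two lowest coefficients nearly cancel, with
about Q r₂ and Q r₁ choices left (`exists_family`). In all this gives about Q^(n+1) r₁ r₂
polynomials.

Congruences modulo 4 make each of them Eisenstein at 2, so its roots are conjugate. It need not be
primitive, and several may share a point, but those have different contents (`eq_of_common_root`). A
content k divides the three lowest coefficients, which happens for a proportion O(k⁻²) of the family
once Q r₁ r₂ is large; this is the role of c₀. Hence half of the family has content at most 3000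
(`half_le_card_filter`), and each point is counted at most 3000 times.

Avoiding the strip forces r₁, r₂ ≤ |d₁ - d₂|, so the constants need only n and d. -/

/-! ### Height, finiteness and symmetry. -/

theorem natAbs_coeff_le_polyHeight (P : ℤ[X]) (j : ℕ) : (P.coeff j).natAbs ≤ polyHeight P := by
  by_cases h : j ∈ P.support
  · exact Finset.le_sup (f := fun j => (P.coeff j).natAbs) h
  · simp [notMem_support_iff.1 h]

theorem polyHeight_le_iff {P : ℤ[X]} {H : ℕ} :
    polyHeight P ≤ H ↔ ∀ j, (P.coeff j).natAbs ≤ H :=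
  ⟨fun h j => (natAbs_coeff_le_polyHeight P j).trans h, fun h => Finset.sup_le fun j _ => h j⟩

/-- Needed because `Set.ncard` is 0 on infinite sets, so it is monotone only under finiteness. -/
theorem finite_algebraicPoints (n : ℕ) (Q : ℝ) : (algebraicPoints n Q).Finite := by
  classical
  have hU : (Set.Icc (-(⌈|Q|⌉)) ⌈|Q|⌉ : Set ℤ).Finite := Set.finite_Icc _ _
  have hfin := bUnion_roots_finite (algebraMap ℤ ℝ) n hU
  refine (hfin.prod hfin).subset ?_
  rintro ⟨x, y⟩ ⟨-, P, ⟨hprim, ⟨hx, hy⟩, -⟩, hdeg, hH⟩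
  have hP0 : P.map (algebraMap ℤ ℝ) ≠ 0 :=
    (Polynomial.map_ne_zero_iff (RingHom.injective_int (algebraMap ℤ ℝ))).2 hprim.ne_zero
  have hmem : P.natDegree ≤ n ∧ ∀ i, P.coeff i ∈ Set.Icc (-(⌈|Q|⌉)) ⌈|Q|⌉ := by
    refine ⟨hdeg, fun i => ?_⟩
    rw [Set.mem_Icc, ← abs_le]
    have h1 : ((P.coeff i).natAbs : ℝ) ≤ |Q| :=
      (Nat.cast_le.2 (natAbs_coeff_le_polyHeight P i)).trans (hH.trans (le_abs_self Q))
    rw [Nat.cast_natAbs] at h1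
    exact_mod_cast h1.trans (Int.le_ceil _)
  have key : ∀ z : ℝ, aeval z P = 0 → z ∈ (P.map (algebraMap ℤ ℝ)).roots.toFinset := by
    intro z hz
    rw [Multiset.mem_toFinset, mem_roots hP0, IsRoot.def, eval_map_algebraMap, hz]
  exact ⟨Set.mem_iUnion₂.2 ⟨P, hmem, key x hx⟩, Set.mem_iUnion₂.2 ⟨P, hmem, key y hy⟩⟩

theorem algebraicPoints_swap {n : ℕ} {Q : ℝ} {α : ℝ × ℝ} (h : α ∈ algebraicPoints n Q) :
    α.swap ∈ algebraicPoints n Q := by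
  obtain ⟨hc, P, ⟨h1, h2, h3⟩, h4⟩ := h
  exact ⟨hc.symm, P, ⟨h1, h2.symm, fun R hR hr => h3 R hR hr.symm⟩, h4⟩

/-! ### Eisenstein polynomials at 2, not necessarily primitive. -/

theorem not_two_dvd_content {P : ℤ[X]} (hP : P.IsEisensteinAt (Ideal.span {2})) :
    ¬ (2 : ℤ) ∣ P.content := fun h =>
  hP.leading (Ideal.mem_span_singleton.2 (h.trans (content_dvd_coeff _)))

/-- The content is odd, so dividing it out does not affect divisibility by 2; this reduces
irreducibility over ℚ to the primitive case. -/
theorem isEisensteinAt_primPart {P : ℤ[X]} (hP : P.IsEisensteinAt (Ideal.span {2})) :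
    P.primPart.IsEisensteinAt (Ideal.span {2}) := by
  have hc : ∀ j, P.coeff j = P.content * P.primPart.coeff j := fun j => by
    conv_lhs => rw [P.eq_C_content_mul_primPart]
    rw [coeff_C_mul]
  refine ⟨fun h => ?_, fun {j} hj => ?_, fun h => ?_⟩
  · rw [Ideal.mem_span_singleton, leadingCoeff, natDegree_primPart] at h
    exact hP.leading (Ideal.mem_span_singleton.2 (by
      rw [leadingCoeff, hc]; exact h.mul_left _))
  · rw [natDegree_primPart] at hj
    have := hP.mem hj
    rw [Ideal.mem_span_singleton, hc] at this
    exact Ideal.mem_span_singleton.2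
      ((Int.prime_two.dvd_or_dvd this).resolve_left (not_two_dvd_content hP))
  · rw [Ideal.span_singleton_pow, Ideal.mem_span_singleton] at h
    apply hP.notMem
    rw [Ideal.span_singleton_pow, Ideal.mem_span_singleton, hc]
    exact h.mul_left _

theorem irreducible_map_primPart {P : ℤ[X]} (hP : P.IsEisensteinAt (Ideal.span {2}))
    (hdeg : 0 < P.natDegree) : Irreducible (P.primPart.map (Int.castRingHom ℚ)) := by
  rw [← IsPrimitive.Int.irreducible_iff_irreducible_map_cast P.isPrimitive_primPart]
  refine (isEisensteinAt_primPart hP).irreducible ?_ P.isPrimitive_primPart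
    (by rwa [natDegree_primPart])
  exact (Ideal.span_singleton_prime two_ne_zero).2 Int.prime_two

theorem irreducible_map_of_isEisensteinAt {P : ℤ[X]} (hP : P.IsEisensteinAt (Ideal.span {2}))
    (hdeg : 0 < P.natDegree) : Irreducible (P.map (Int.castRingHom ℚ)) := by
  have h := irreducible_map_primPart hP hdeg
  rw [P.eq_C_content_mul_primPart, Polynomial.map_mul, map_C]
  refine (irreducible_isUnit_mul (isUnit_C.2 (IsUnit.mk0 _ ?_))).2 h
  have h0 : P.content ≠ 0 := fun h0 => not_two_dvd_content hP (h0 ▸ dvd_zero _)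
  simpa using h0

theorem aeval_map_intCast (P : ℤ[X]) (x : ℝ) :
    aeval x (P.map (Int.castRingHom ℚ)) = aeval x P := by
  rw [← algebraMap_int_eq, aeval_map_algebraMap]

theorem minpoly_eq_of_isEisensteinAt {P : ℤ[X]} (hP : P.IsEisensteinAt (Ideal.span {2}))
    (hdeg : 0 < P.natDegree) {x : ℝ} (hx : aeval x P = 0) :
    P.map (Int.castRingHom ℚ) * C ((P.leadingCoeff : ℚ)⁻¹) = minpoly ℚ x := by
  have := minpoly.eq_of_irreducible (irreducible_map_of_isEisensteinAt hP hdeg)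
    (x := x) (by rw [aeval_map_intCast, hx])
  rw [← this, leadingCoeff_map_of_injective (RingHom.injective_int _)]
  simp

theorem natDegree_minpoly_of_isEisensteinAt {P : ℤ[X]} (hP : P.IsEisensteinAt (Ideal.span {2}))
    (hdeg : 0 < P.natDegree) {x : ℝ} (hx : aeval x P = 0) :
    (minpoly ℚ x).natDegree = P.natDegree := by
  have h0 : P ≠ 0 := ne_zero_of_natDegree_gt hdeg
  rw [← minpoly_eq_of_isEisensteinAt hP hdeg hx, natDegree_mul_C
    (by simpa using h0), natDegree_map_eq_of_injective (RingHom.injective_int _)]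

theorem mem_algebraicPoints_of_isEisensteinAt {P : ℤ[X]} {n : ℕ} {Q : ℝ}
    (hP : P.IsEisensteinAt (Ideal.span {2})) (hdeg : 0 < P.natDegree) (hn : P.natDegree ≤ n)
    (hQ : (polyHeight P : ℝ) ≤ Q) {x y : ℝ} (hx : aeval x P = 0) (hy : aeval y P = 0) :
    (x, y) ∈ algebraicPoints n Q := by
  have hc0 : P.content ≠ 0 := fun h0 => not_two_dvd_content hP (h0 ▸ dvd_zero _)
  have hroot : ∀ z : ℝ, aeval z P = 0 → aeval z P.primPart = 0 := by
    intro z hz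
    rw [P.eq_C_content_mul_primPart, map_mul, aeval_C, mul_eq_zero] at hz
    refine hz.resolve_left ?_
    simpa using hc0
  refine ⟨?_, P.primPart, ⟨P.isPrimitive_primPart, ⟨hroot x hx, hroot y hy⟩, ?_⟩, ?_, ?_⟩
  · change minpoly ℚ x = minpoly ℚ y
    rw [← minpoly_eq_of_isEisensteinAt hP hdeg hx, minpoly_eq_of_isEisensteinAt hP hdeg hy]
  · intro R hR hr
    rw [natDegree_primPart, ← natDegree_minpoly_of_isEisensteinAt hP hdeg hx,
      ← natDegree_map_eq_of_injective (RingHom.injective_int (Int.castRingHom ℚ)) R]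
    refine natDegree_le_of_dvd (minpoly.dvd _ _ (by rw [aeval_map_intCast, hr.1])) ?_
    exact (Polynomial.map_ne_zero_iff (RingHom.injective_int _)).2 hR.ne_zero
  · rwa [natDegree_primPart]
  · refine le_trans (Nat.cast_le.2 ?_) hQ
    refine polyHeight_le_iff.2 fun j => le_trans ?_ (natAbs_coeff_le_polyHeight P j)
    conv_rhs => rw [P.eq_C_content_mul_primPart, coeff_C_mul, Int.natAbs_mul]
    exact Nat.le_mul_of_pos_left _ (Int.natAbs_pos.2 hc0)

/-- Eisenstein polynomials with positive leading coefficient, equal content and a common root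
coincide. -/
theorem eq_of_common_root {P R : ℤ[X]} (hP : P.IsEisensteinAt (Ideal.span {2}))
    (hR : R.IsEisensteinAt (Ideal.span {2})) (hPdeg : 0 < P.natDegree) (hRdeg : 0 < R.natDegree)
    (hPl : 0 < P.leadingCoeff) (hRl : 0 < R.leadingCoeff) (hc : P.content = R.content)
    {x : ℝ} (hPx : aeval x P = 0) (hRx : aeval x R = 0) : P = R := by
  have h := (minpoly_eq_of_isEisensteinAt hP hPdeg hPx).trans
    (minpoly_eq_of_isEisensteinAt hR hRdeg hRx).symm
  have hPl' : (P.leadingCoeff : ℚ) ≠ 0 := by exact_mod_cast hPl.ne'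
  have hRl' : (R.leadingCoeff : ℚ) ≠ 0 := by exact_mod_cast hRl.ne'
  -- Both are rational multiples of one minimal polynomial; comparing contents below then equates
  -- the leading coefficients.
  have h2 : C R.leadingCoeff * P = C P.leadingCoeff * R := by
    apply map_injective (Int.castRingHom ℚ) (RingHom.injective_int _)
    ext j
    have hj := congrArg (fun p => p.coeff j) h
    simp only [coeff_mul_C, coeff_map, eq_intCast] at hj
    simp only [coeff_map, coeff_C_mul]
    simp only [eq_intCast, Int.cast_mul]
    field_simp at hj
    linarith
  have h3 := congrArg content h2
  have hc0 : R.content ≠ 0 := fun h0 => not_two_dvd_content hR (h0 ▸ dvd_zero _)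
  rw [content_C_mul, content_C_mul, hc, Int.normalize_of_nonneg hPl.le,
    Int.normalize_of_nonneg hRl.le] at h3
  have h4 := mul_right_cancel₀ hc0 h3
  rw [h4] at h2
  exact mul_left_cancel₀ (C_ne_zero.2 hPl.ne') h2

/-! ### Polynomials with prescribed coefficients. -/

/-- The polynomial `∑ j ≤ n, a j * X ^ j`. -/
noncomputable def polyOfCoeffs (n : ℕ) (a : ℕ → ℤ) : ℤ[X] :=
  ∑ j ∈ Finset.range (n + 1), monomial j (a j)

theorem coeff_polyOfCoeffs (n : ℕ) (a : ℕ → ℤ) (j : ℕ) :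
    (polyOfCoeffs n a).coeff j = if j ≤ n then a j else 0 := by
  simp [polyOfCoeffs, coeff_monomial]

theorem aeval_polyOfCoeffs (n : ℕ) (a : ℕ → ℤ) (x : ℝ) :
    aeval x (polyOfCoeffs n a) = ∑ j ∈ Finset.range (n + 1), (a j : ℝ) * x ^ j := by
  simp [polyOfCoeffs, aeval_monomial]

theorem natDegree_polyOfCoeffs {n : ℕ} {a : ℕ → ℤ} (h : a n ≠ 0) :
    (polyOfCoeffs n a).natDegree = n := by
  refine natDegree_eq_of_le_of_coeff_ne_zero ?_ ?_
  · refine natDegree_le_iff_coeff_eq_zero.2 fun j hj => ?_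
    rw [coeff_polyOfCoeffs, if_neg (by omega)]
  · rwa [coeff_polyOfCoeffs, if_pos le_rfl]

theorem isEisensteinAt_polyOfCoeffs {n : ℕ} {a : ℕ → ℤ} (hn : ¬ (2 : ℤ) ∣ a n)
    (h : ∀ j < n, (2 : ℤ) ∣ a j) (h0 : ¬ (4 : ℤ) ∣ a 0) :
    (polyOfCoeffs n a).IsEisensteinAt (Ideal.span {2}) := by
  have hd : (polyOfCoeffs n a).natDegree = n :=
    natDegree_polyOfCoeffs fun h => hn (h ▸ dvd_zero _)
  refine ⟨?_, ?_, ?_⟩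
  · rw [leadingCoeff, hd, coeff_polyOfCoeffs, if_pos le_rfl, Ideal.mem_span_singleton]
    exact hn
  · intro j hj
    rw [hd] at hj
    rw [coeff_polyOfCoeffs, if_pos hj.le, Ideal.mem_span_singleton]
    exact h j hj
  · rw [Ideal.span_singleton_pow, Ideal.mem_span_singleton, coeff_polyOfCoeffs,
      if_pos (Nat.zero_le _)]
    norm_num
    exact h0

/-! ### Division by (x - d₁)(x - d₂) and location of roots. -/

theorem exists_pow_interpolation (d₁ d₂ : ℝ) :
    ∃ (g : ℕ → ℝ → ℝ) (u v : ℕ → ℝ), (∀ j, Continuous (g j)) ∧ (∀ x, g 0 x = 1) ∧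
      ∀ j x, x ^ (j + 2) = (x - d₁) * (x - d₂) * g j x + u j + v j * x := by
  have step : ∀ j : ℕ, ∃ (g : ℝ → ℝ) (u v : ℝ), Continuous g ∧ (j = 0 → ∀ x, g x = 1) ∧
      ∀ x, x ^ (j + 2) = (x - d₁) * (x - d₂) * g x + u + v * x := by
    intro j
    induction j with
    | zero =>
      exact ⟨fun _ => 1, -(d₁ * d₂), d₁ + d₂, continuous_const, fun _ _ => rfl, fun x => by ring⟩
    | succ j ih =>
      obtain ⟨g, u, v, hg, -, h⟩ := ih
      refine ⟨fun x => x * g x + v, -(v * d₁ * d₂), u + v * (d₁ + d₂), by fun_prop,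
        fun h => absurd h (Nat.succ_ne_zero _), fun x => ?_⟩
      rw [show j + 1 + 2 = (j + 2) + 1 by ring, pow_succ, h x]
      ring
  choose g u v hg h0 h using step
  exact ⟨g, u, v, hg, h0 0 rfl, h⟩

/-- At p ± ρ the main term has opposite signs and, since q is at distance at least |p - q|/2 from
both, modulus at least ρ(|p - q|/2)M. The error cannot undo the sign change. -/
theorem exists_root_near {p q ρ M : ℝ} {f G : ℝ → ℝ} (hf : Continuous f) (hρ : 0 < ρ)
    (hρ' : ρ ≤ |p - q| / 2) (hM : 0 < M)
    (hG : ∀ x, |x - p| ≤ ρ → M ≤ G x)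
    (he : ∀ x, |x - p| ≤ ρ → |f x - (x - p) * (x - q) * G x| < ρ * (|p - q| / 2) * M) :
    ∃ x, f x = 0 ∧ |x - p| < 2 * ρ := by
  have hab : p - ρ ≤ p + ρ := by linarith
  have h1 : |p + ρ - p| ≤ ρ := by rw [add_sub_cancel_left, abs_of_pos hρ]
  have h2 : |p - ρ - p| ≤ ρ := by rw [sub_sub_cancel_left, abs_neg, abs_of_pos hρ]
  have e1 := he _ h1
  have e2 := he _ h2
  have G1 := hG _ h1
  have G2 := hG _ h2
  rw [abs_lt] at e1 e2
  have hin : ∀ x ∈ Set.Icc (p - ρ) (p + ρ), |x - p| < 2 * ρ := by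
    rintro x ⟨hx1, hx2⟩
    rw [abs_lt]
    constructor <;> linarith
  rcases le_total q p with hqp | hqp
  · rw [abs_of_nonneg (by linarith)] at hρ' e1 e2
    have k1 : ρ * ((p - q) / 2) * M ≤ (p + ρ - p) * (p + ρ - q) * G (p + ρ) := by
      apply mul_le_mul _ G1 hM.le <;> nlinarith
    have k2 : (p - ρ - p) * (p - ρ - q) * G (p - ρ) ≤ -(ρ * ((p - q) / 2) * M) := by
      have : ρ * ((p - q) / 2) * M ≤ ρ * (p - ρ - q) * G (p - ρ) := by
        apply mul_le_mul _ G2 hM.le <;> nlinarith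
      linarith
    obtain ⟨x, hx, hfx⟩ := intermediate_value_Icc hab hf.continuousOn
      (show (0 : ℝ) ∈ Set.Icc (f (p - ρ)) (f (p + ρ)) by constructor <;> linarith)
    exact ⟨x, hfx, hin x hx⟩
  · rw [abs_of_nonpos (by linarith)] at hρ' e1 e2
    have k1 : (p + ρ - p) * (p + ρ - q) * G (p + ρ) ≤ -(ρ * (-(p - q) / 2) * M) := by
      have : ρ * (-(p - q) / 2) * M ≤ ρ * (q - p - ρ) * G (p + ρ) := by
        apply mul_le_mul _ G1 hM.le <;> nlinarith
      linarith
    have k2 : ρ * (-(p - q) / 2) * M ≤ (p - ρ - p) * (p - ρ - q) * G (p - ρ) := by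
      have : ρ * (-(p - q) / 2) * M ≤ ρ * (q - p + ρ) * G (p - ρ) := by
        apply mul_le_mul _ G2 hM.le <;> nlinarith
      linarith
    obtain ⟨x, hx, hfx⟩ := intermediate_value_Icc' hab hf.continuousOn
      (show (0 : ℝ) ∈ Set.Icc (f (p + ρ)) (f (p - ρ)) by constructor <;> linarith)
    exact ⟨x, hfx, hin x hx⟩

/-- A quadratic-like function with small error terms has zeros near `d₁` and near `d₂`. -/
theorem exists_roots_near {d₁ d₂ r₁ r₂ M B E : ℝ} {f G : ℝ → ℝ} (hf : Continuous f)
    (hr₁ : 0 < r₁) (hr : r₁ ≤ r₂) (hr₂ : r₂ ≤ |d₁ - d₂|) (hM : 0 < M)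
    (hG : ∀ x, |x - d₁| ≤ 2 * |d₁ - d₂| → M ≤ G x)
    (hfG : ∀ x, f x = (x - d₁) * (x - d₂) * G x + E + B * (x - d₁))
    (hB : (1 + 2 * |d₁ - d₂|) * |B| ≤ r₂ * |d₁ - d₂| * M / 16)
    (hE : (1 + 2 * |d₁ - d₂|) * |E| ≤ r₁ * |d₁ - d₂| * M / 16) :
    ∃ x y, f x = 0 ∧ f y = 0 ∧ |x - d₁| < r₁ ∧ |y - d₂| < r₂ := by
  have hr₂0 : 0 < r₂ := hr₁.trans_le hr
  set D := |d₁ - d₂| with hD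
  have hD0 : 0 < D := hr₂0.trans_le hr₂
  have hEa := abs_nonneg E
  have hBa := abs_nonneg B
  have herr : ∀ x, |f x - (x - d₁) * (x - d₂) * G x| ≤ |E| + |B| * |x - d₁| := by
    intro x
    rw [hfG, ← abs_mul, add_assoc, add_sub_cancel_left]
    exact abs_add_le _ _
  have hDM : 0 < D * M := mul_pos hD0 hM
  have hr₁M : 0 < r₁ * (D * M) := mul_pos hr₁ hDM
  have hr₂M : 0 < r₂ * (D * M) := mul_pos hr₂0 hDM
  have hrM : r₁ * (D * M) ≤ r₂ * (D * M) := mul_le_mul_of_nonneg_right hr hDM.le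
  have hBD : 0 ≤ D * |B| := mul_nonneg hD0.le hBa
  have hED : 0 ≤ D * |E| := mul_nonneg hD0.le hEa
  obtain ⟨x, hx, hx'⟩ := exists_root_near (p := d₁) (q := d₂) (ρ := r₁ / 2) (M := M) (G := G) hf
    (by linarith) (by rw [← hD]; linarith) hM
    (fun x hx => hG x (by linarith)) (fun x hx => by
      refine (herr x).trans_lt ?_
      rw [← hD]
      have h1 : |B| * |x - d₁| ≤ |B| * (r₁ / 2) := mul_le_mul_of_nonneg_left hx hBa
      -- Near d₁ the bound on B is used with r₂ ≤ D; the factor |x - d₁| ≤ r₁/2 then brings the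
      -- linear term down to the scale r₁.
      have h2 : |B| ≤ D * M / 32 := by
        have : 2 * D * |B| ≤ D * (D * M) / 16 := by
          have : r₂ * (D * M) ≤ D * (D * M) := mul_le_mul_of_nonneg_right hr₂ hDM.le
          linarith
        have : D * |B| ≤ D * (D * M / 32) := by linarith
        exact le_of_mul_le_mul_left this hD0
      have h3 : |B| * (r₁ / 2) ≤ D * M / 32 * (r₁ / 2) :=
        mul_le_mul_of_nonneg_right h2 (by linarith)
      linarith)
  obtain ⟨y, hy, hy'⟩ := exists_root_near (p := d₂) (q := d₁) (ρ := r₂ / 2) (M := M) (G := G) hf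
    (by linarith) (by rw [abs_sub_comm, ← hD]; linarith) hM
    (fun y hy => hG y (by
      have := abs_sub_le y d₂ d₁
      rw [abs_sub_comm d₂ d₁, ← hD] at this
      linarith)) (fun y hy => by
      rw [abs_sub_comm d₂ d₁, ← hD, mul_comm (y - d₂)]
      refine (herr y).trans_lt ?_
      have h0 : |y - d₁| ≤ 2 * D := by
        have := abs_sub_le y d₂ d₁
        rw [abs_sub_comm d₂ d₁, ← hD] at this
        linarith
      have h1 : |B| * |y - d₁| ≤ |B| * (2 * D) := mul_le_mul_of_nonneg_left h0 hBa
      linarith)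
  exact ⟨x, y, hx, hy, by linarith, by linarith⟩

/-! ### Counting coefficients with a large common divisor. -/

theorem card_filter_dvd_le (N k : ℕ) (hk : 0 < k) (c : ℤ) :
    (((Finset.range N).filter fun t : ℕ => (k : ℤ) ∣ 4 * (t : ℤ) + c).card : ℝ)
      ≤ 4 * N / k + 1 := by
  have hkR : (0 : ℝ) < k := Nat.cast_pos.2 hk
  have hkZ : (k : ℤ) ≠ 0 := by exact_mod_cast hk.ne'
  have hcard : ((Finset.range N).filter fun t : ℕ => (k : ℤ) ∣ 4 * (t : ℤ) + c).card
      ≤ (Finset.Icc ⌈(c : ℝ) / k⌉ ⌊((4 * N + c : ℝ)) / k⌋).card := by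
    refine Finset.card_le_card_of_injOn (fun t : ℕ => (4 * (t : ℤ) + c) / k) ?_ ?_
    · intro t ht
      obtain ⟨h1, q, hq⟩ := Finset.mem_filter.1 (Finset.mem_coe.1 ht)
      have h1' : (t : ℝ) < N := Nat.cast_lt.2 (Finset.mem_range.1 h1)
      have hq' : (4 * t + c : ℝ) = k * q := by exact_mod_cast hq
      simp only [hq, Int.mul_ediv_cancel_left _ hkZ, Finset.coe_Icc, Set.mem_Icc]
      constructor
      · rw [Int.ceil_le, div_le_iff₀ hkR]
        have : (0 : ℝ) ≤ t := Nat.cast_nonneg _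
        linarith
      · rw [Int.le_floor, le_div_iff₀ hkR]
        linarith
    · intro t ht s hs hts
      obtain ⟨-, q, hq⟩ := Finset.mem_filter.1 (Finset.mem_coe.1 ht)
      obtain ⟨-, q', hq'⟩ := Finset.mem_filter.1 (Finset.mem_coe.1 hs)
      simp only [hq, hq', Int.mul_ediv_cancel_left _ hkZ] at hts
      subst hts
      omega
  refine (Nat.cast_le.2 hcard).trans ?_
  rw [Int.card_Icc]
  have hnn : (0 : ℝ) ≤ 4 * N / k + 1 := by positivity
  have h1 := Int.le_ceil ((c : ℝ) / k)
  have h2 := Int.floor_le ((4 * N + c : ℝ) / k)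
  rw [add_div] at h2
  rcases le_total (⌊(4 * N + c : ℝ) / k⌋ + 1 - ⌈(c : ℝ) / k⌉) 0 with h | h
  · rw [Int.toNat_of_nonpos h]
    simpa using hnn
  · have : ((⌊(4 * N + c : ℝ) / k⌋ + 1 - ⌈(c : ℝ) / k⌉).toNat : ℝ)
        = ((⌊(4 * N + c : ℝ) / k⌋ + 1 - ⌈(c : ℝ) / k⌉ : ℤ) : ℝ) := by
      exact_mod_cast congrArg (Int.cast (R := ℝ)) (Int.toNat_of_nonneg h)
    rw [this]
    push_cast
    rw [add_div]
    linarith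

/-- Fibrewise count that allows the shift of a coefficient to depend on those chosen before it, as
in the family. -/
theorem card_filter_prod_dvd_le {ι : Type*} (S : Finset ι) (p : ι → Prop) [DecidablePred p]
    (N k : ℕ) (hk : 0 < k) (c : ι → ℤ) {X : ℝ} (hX : ((S.filter p).card : ℝ) ≤ X) :
    (((S ×ˢ Finset.range N).filter
      fun x => p x.1 ∧ (k : ℤ) ∣ 4 * (x.2 : ℤ) + c x.1).card : ℝ) ≤ X * (4 * N / k + 1) := by
  classical
  set T := (S ×ˢ Finset.range N).filter fun x => p x.1 ∧ (k : ℤ) ∣ 4 * (x.2 : ℤ) + c x.1 with hT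
  have hmaps : Set.MapsTo Prod.fst (T : Set (ι × ℕ)) (S.filter p : Finset ι) := by
    intro x hx
    obtain ⟨h1, h2, -⟩ := Finset.mem_filter.1 (Finset.mem_coe.1 hx)
    exact Finset.mem_coe.2 (Finset.mem_filter.2 ⟨(Finset.mem_product.1 h1).1, h2⟩)
  rw [Finset.card_eq_sum_card_fiberwise hmaps, Nat.cast_sum]
  have hnn : (0 : ℝ) ≤ 4 * N / k + 1 := by positivity
  calc ∑ b ∈ S.filter p, ((T.filter fun a => a.1 = b).card : ℝ)
      ≤ ∑ _b ∈ S.filter p, (4 * (N : ℝ) / k + 1) := by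
        refine Finset.sum_le_sum fun b _ => le_trans (Nat.cast_le.2 ?_)
          (card_filter_dvd_le N k hk (c b))
        refine Finset.card_le_card_of_injOn Prod.snd ?_ ?_
        · intro x hx
          obtain ⟨h1, h2⟩ := Finset.mem_filter.1 (Finset.mem_coe.1 hx)
          obtain ⟨h3, -, h5⟩ := Finset.mem_filter.1 h1
          subst h2
          exact Finset.mem_coe.2 (Finset.mem_filter.2 ⟨(Finset.mem_product.1 h3).2, h5⟩)
        · intro x hx y hy hxy
          have hx' := (Finset.mem_filter.1 (Finset.mem_coe.1 hx)).2
          have hy' := (Finset.mem_filter.1 (Finset.mem_coe.1 hy)).2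
          exact Prod.ext (hx'.trans hy'.symm) hxy
    _ = ((S.filter p).card : ℝ) * (4 * N / k + 1) := by rw [Finset.sum_const, nsmul_eq_mul]
    _ ≤ X * (4 * N / k + 1) := mul_le_mul_of_nonneg_right hX hnn

theorem card_filter_triple_dvd_le {ι : Type*} (U : Finset ι) (N₂ N₁ N₀ k : ℕ) (hk : 0 < k)
    (c₂ : ι → ℤ) (c₁ : ι × ℕ → ℤ) (c₀ : (ι × ℕ) × ℕ → ℤ) :
    ((((((U ×ˢ Finset.range N₂) ×ˢ Finset.range N₁) ×ˢ Finset.range N₀)).filter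
      fun x => (((k : ℤ) ∣ 4 * (x.1.1.2 : ℤ) + c₂ x.1.1.1) ∧
        (k : ℤ) ∣ 4 * (x.1.2 : ℤ) + c₁ x.1.1) ∧ (k : ℤ) ∣ 4 * (x.2 : ℤ) + c₀ x.1).card : ℝ)
      ≤ U.card * (4 * N₂ / k + 1) * (4 * N₁ / k + 1) * (4 * N₀ / k + 1) := by
  have h2 := card_filter_prod_dvd_le U (fun _ => True) N₂ k hk c₂ (X := U.card) (by simp)
  simp only [true_and] at h2
  exact card_filter_prod_dvd_le _ _ N₀ k hk c₀ (card_filter_prod_dvd_le _ _ N₁ k hk c₁ h2)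

/-- If `N₀ N₁ ≥ N₂` then only few triples are divisible by some `k > K`. -/
theorem half_le_card_filter {ι : Type*} (U : Finset ι) {N₂ N₁ N₀ K : ℕ}
    (hN₁ : 0 < N₁) (hN₀ : 0 < N₀) (hN : N₂ ≤ N₀ * N₁) (hK : 3000 ≤ K)
    (c₂ : ι → ℤ) (c₁ : ι × ℕ → ℤ) (c₀ : (ι × ℕ) × ℕ → ℤ)
    (k : ((ι × ℕ) × ℕ) × ℕ → ℕ) (S : Finset (((ι × ℕ) × ℕ) × ℕ))
    (hS : S = ((U ×ˢ Finset.range N₂) ×ˢ Finset.range N₁) ×ˢ Finset.range N₀)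
    (hk : ∀ x ∈ S, k x ≤ 9 * N₂ ∧ (k x : ℤ) ∣ 4 * (x.1.1.2 : ℤ) + c₂ x.1.1.1 ∧
      (k x : ℤ) ∣ 4 * (x.1.2 : ℤ) + c₁ x.1.1 ∧ (k x : ℤ) ∣ 4 * (x.2 : ℤ) + c₀ x.1) :
    (U.card * N₂ * N₁ * N₀ : ℝ) / 2 ≤ (S.filter fun x => k x ≤ K).card := by
  classical
  have hcardS : (S.card : ℝ) = U.card * N₂ * N₁ * N₀ := by
    rw [hS]; simp [Finset.card_product]
  have hsplit : ((S.filter fun x => k x ≤ K).card : ℝ) + (S.filter fun x => ¬ k x ≤ K).card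
      = S.card := by
    exact_mod_cast Finset.card_filter_add_card_filter_not (s := S) (fun x => k x ≤ K)
  set T := S.filter fun x => ¬ k x ≤ K with hT
  have hmaps : Set.MapsTo k (T : Set (((ι × ℕ) × ℕ) × ℕ)) (Finset.Ioc K (9 * N₂) : Finset ℕ) := by
    intro x hx
    obtain ⟨h1, h2⟩ := Finset.mem_filter.1 (Finset.mem_coe.1 hx)
    exact Finset.mem_coe.2 (Finset.mem_Ioc.2 ⟨not_le.1 h2, (hk x h1).1⟩)
  have hN₁' : (1 : ℝ) ≤ N₁ := by exact_mod_cast hN₁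
  have hN₀' : (1 : ℝ) ≤ N₀ := by exact_mod_cast hN₀
  have hN' : (N₂ : ℝ) ≤ N₀ * N₁ := by exact_mod_cast hN
  set W : ℝ := U.card * N₂ * N₁ * N₀ with hW
  have hW0 : 0 ≤ W := by positivity
  -- One factor 1/b comes from the coefficient with N₂ choices, the other from the remaining two
  -- together; b ≤ 9N₂ ≤ 9N₀N₁ absorbs the `+ 1` terms. The constants are 13 = 4 + 9, 33 = 16 + 4 +
  -- 4 + 9 and 429 = 13 · 33.
  have hfib : ∀ b ∈ Finset.Ioc K (9 * N₂),
      ((T.filter fun x => k x = b).card : ℝ) ≤ 429 * W * ((b : ℝ) ^ 2)⁻¹ := by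
    intro b hb
    obtain ⟨hb1, hb2⟩ := Finset.mem_Ioc.1 hb
    have hb0 : 0 < b := by omega
    have hbR : (0 : ℝ) < b := Nat.cast_pos.2 hb0
    have hbN : (b : ℝ) ≤ 9 * N₂ := by exact_mod_cast hb2
    have hle : ((T.filter fun x => k x = b).card : ℝ) ≤ _ :=
      le_trans (Nat.cast_le.2 (Finset.card_le_card ?_))
        (card_filter_triple_dvd_le U N₂ N₁ N₀ b hb0 c₂ c₁ c₀)
    · refine hle.trans ?_
      have e2 : 4 * (N₂ : ℝ) / b + 1 ≤ 13 * N₂ / b := by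
        rw [div_add_one hbR.ne']
        gcongr
        linarith
      have e01 : (4 * (N₁ : ℝ) / b + 1) * (4 * N₀ / b + 1) ≤ 33 * (N₀ * N₁) / b := by
        have hb1' : (1 : ℝ) ≤ b := by exact_mod_cast hb0
        have hprod : (4 * (N₁ : ℝ) / b + 1) * (4 * N₀ / b + 1)
            = (16 * (N₀ * N₁) / b + 4 * N₁ + 4 * N₀ + b) / b := by
          field_simp
          ring
        rw [hprod]
        gcongr
        have : 16 * ((N₀ : ℝ) * N₁) / b ≤ 16 * (N₀ * N₁) := by
          apply div_le_self (by positivity) hb1'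
        nlinarith
      have hU0 : (0 : ℝ) ≤ U.card := Nat.cast_nonneg _
      calc (U.card : ℝ) * (4 * N₂ / b + 1) * (4 * N₁ / b + 1) * (4 * N₀ / b + 1)
          = U.card * ((4 * N₂ / b + 1) * ((4 * N₁ / b + 1) * (4 * N₀ / b + 1))) := by ring
        _ ≤ U.card * ((13 * N₂ / b) * (33 * (N₀ * N₁) / b)) := by gcongr
        _ = 429 * W * ((b : ℝ) ^ 2)⁻¹ := by
          rw [hW]
          field_simp
          ring
    · intro x hx
      obtain ⟨h1, h2⟩ := Finset.mem_filter.1 hx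
      have h3 := (Finset.mem_filter.1 h1).1
      obtain ⟨-, h4, h5, h6⟩ := hk x h3
      rw [h2] at h4 h5 h6
      exact Finset.mem_filter.2 ⟨hS ▸ h3, ⟨h4, h5⟩, h6⟩
  have hbad : (T.card : ℝ) ≤ W / 2 := by
    rw [Finset.card_eq_sum_card_fiberwise hmaps, Nat.cast_sum]
    refine (Finset.sum_le_sum hfib).trans ?_
    rw [← Finset.mul_sum]
    have hs : ∑ b ∈ Finset.Ioc K (9 * N₂), ((b : ℝ) ^ 2)⁻¹ ≤ 2 / (K + 1) := by
      refine le_trans (Finset.sum_le_sum_of_subset_of_nonneg (t := Finset.Ioo K (9 * N₂ + 1)) ?_ ?_)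
        (sum_Ioo_inv_sq_le K (9 * N₂ + 1))
      · intro b hb
        rw [Finset.mem_Ioc] at hb
        rw [Finset.mem_Ioo]
        omega
      · intros
        positivity
    have hK' : (2 : ℝ) / (K + 1) ≤ 1 / 858 := by
      have : (3000 : ℝ) ≤ K := by exact_mod_cast hK
      rw [div_le_div_iff₀ (by linarith) (by norm_num)]
      linarith
    calc 429 * W * ∑ b ∈ Finset.Ioc K (9 * N₂), ((b : ℝ) ^ 2)⁻¹ ≤ 429 * W * (1 / 858) := by
          gcongr
          exact hs.trans hK'
      _ = W / 2 := by ring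
  linarith

/-! ### The Eisenstein family and the points it yields. -/

/-- The coefficients of `X ^ 2, X ^ 3, …, X ^ (m + 2)` of a polynomial of the family. -/
def upperCoeffs (m N : ℕ) (x : (Fin m → ℕ) × ℕ) : ℕ → ℤ
  | 0 => 4 * (x.2 : ℤ) + (4 * (N : ℤ) + if m = 0 then 1 else 0)
  | j + 1 => if h : j < m then 4 * (x.1 ⟨j, h⟩ : ℤ) + (if j + 1 = m then 1 else 0) else 0

/-- The coefficients of a polynomial of the family, Eisenstein at `2`; the two lowest ones are
shifted by amounts that depend on the coefficients above them. -/
def coeffVec (m N : ℕ) (z₁ : (Fin m → ℕ) × ℕ → ℤ) (z₀ : ((Fin m → ℕ) × ℕ) × ℕ → ℤ)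
    (x : (((Fin m → ℕ) × ℕ) × ℕ) × ℕ) : ℕ → ℤ
  | 0 => 4 * (x.2 : ℤ) + (4 * z₀ x.1 + 2)
  | 1 => 4 * (x.1.2 : ℤ) + 4 * z₁ x.1.1
  | j + 2 => upperCoeffs m N x.1.1 j

section Family

variable {m N : ℕ} {z₁ : (Fin m → ℕ) × ℕ → ℤ} {z₀ : ((Fin m → ℕ) × ℕ) × ℕ → ℤ}

theorem upperCoeffs_last (x : (Fin m → ℕ) × ℕ) :
    0 < upperCoeffs m N x m ∧ ¬ (2 : ℤ) ∣ upperCoeffs m N x m := by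
  cases m with
  | zero => simp only [upperCoeffs, if_true]; omega
  | succ m => simp only [upperCoeffs, Nat.lt_succ_self, dif_pos, if_true]; omega

theorem two_dvd_upperCoeffs (x : (Fin m → ℕ) × ℕ) {j : ℕ} (hj : j < m) :
    (2 : ℤ) ∣ upperCoeffs m N x j := by
  cases j with
  | zero => simp only [upperCoeffs, if_neg hj.ne']; omega
  | succ j =>
    have h1 : j < m := by omega
    simp only [upperCoeffs, dif_pos h1, if_neg hj.ne]
    omega

theorem isEisensteinAt_coeffVec (x : (((Fin m → ℕ) × ℕ) × ℕ) × ℕ) :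
    (polyOfCoeffs (m + 2) (coeffVec m N z₁ z₀ x)).IsEisensteinAt (Ideal.span {2}) := by
  refine isEisensteinAt_polyOfCoeffs (upperCoeffs_last _).2 (fun j hj => ?_) ?_
  · match j with
    | 0 => simp only [coeffVec]; omega
    | 1 => simp only [coeffVec]; omega
    | j + 2 => exact two_dvd_upperCoeffs _ (by omega)
  · simp only [coeffVec]; omega

theorem natDegree_coeffVec (x : (((Fin m → ℕ) × ℕ) × ℕ) × ℕ) :
    (polyOfCoeffs (m + 2) (coeffVec m N z₁ z₀ x)).natDegree = m + 2 :=
  natDegree_polyOfCoeffs (upperCoeffs_last (N := N) x.1.1).1.ne'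

theorem leadingCoeff_coeffVec_pos (x : (((Fin m → ℕ) × ℕ) × ℕ) × ℕ) :
    0 < (polyOfCoeffs (m + 2) (coeffVec m N z₁ z₀ x)).leadingCoeff := by
  rw [leadingCoeff, natDegree_coeffVec, coeff_polyOfCoeffs, if_pos le_rfl]
  exact (upperCoeffs_last _).1

theorem polyOfCoeffs_coeffVec_injective :
    Function.Injective fun x => polyOfCoeffs (m + 2) (coeffVec m N z₁ z₀ x) := by
  intro x y hxy
  have h : ∀ j ≤ m + 2, coeffVec m N z₁ z₀ x j = coeffVec m N z₁ z₀ y j := by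
    intro j hj
    have := congrArg (fun p => p.coeff j) hxy
    simpa only [coeff_polyOfCoeffs, if_pos hj] using this
  obtain ⟨⟨⟨u, t₂⟩, t₁⟩, t₀⟩ := x
  obtain ⟨⟨⟨u', t₂'⟩, t₁'⟩, t₀'⟩ := y
  have hu : u = u' := by
    funext j
    have hj := h (j + 1 + 2) (by omega)
    simp only [coeffVec, upperCoeffs, dif_pos j.2, Fin.eta] at hj
    omega
  subst hu
  have h2 := h 2 (by omega)
  simp only [coeffVec, upperCoeffs] at h2
  obtain rfl : t₂ = t₂' := by omega
  have h1 := h 1 (by omega)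
  simp only [coeffVec] at h1
  obtain rfl : t₁ = t₁' := by omega
  have h0 := h 0 (by omega)
  simp only [coeffVec] at h0
  obtain rfl : t₀ = t₀' := by omega
  rfl

theorem content_coeffVec_nonneg (x : (((Fin m → ℕ) × ℕ) × ℕ) × ℕ) :
    0 ≤ (polyOfCoeffs (m + 2) (coeffVec m N z₁ z₀ x)).content :=
  Int.nonneg_of_normalize_eq_self normalize_content

/-- The index set of the family. -/
def familyIndex (m N N₃ N₁ N₀ : ℕ) : Finset ((((Fin m → ℕ) × ℕ) × ℕ) × ℕ) :=
  (((Fintype.piFinset fun _ : Fin m => Finset.range N₃) ×ˢ Finset.range N) ×ˢ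
    Finset.range N₁) ×ˢ Finset.range N₀

theorem mem_familyIndex {N₃ N₁ N₀ : ℕ} {x : (((Fin m → ℕ) × ℕ) × ℕ) × ℕ} :
    x ∈ familyIndex m N N₃ N₁ N₀ ↔
      (∀ j, x.1.1.1 j < N₃) ∧ x.1.1.2 < N ∧ x.1.2 < N₁ ∧ x.2 < N₀ := by
  simp [familyIndex, and_assoc]

/-- If every polynomial of the family has a pair of roots in `T`, then `T` contains many algebraic
points. -/
theorem card_le_ncard_algebraicPoints {N₃ N₁ N₀ : ℕ} (hN₁ : 0 < N₁) (hN₀ : 0 < N₀)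
    (hN : N ≤ N₀ * N₁) (hNpos : 0 < N) {Q : ℝ} {T : Set (ℝ × ℝ)}
    (hQ : ∀ x ∈ familyIndex m N N₃ N₁ N₀,
      (polyHeight (polyOfCoeffs (m + 2) (coeffVec m N z₁ z₀ x)) : ℝ) ≤ Q)
    (hroots : ∀ x ∈ familyIndex m N N₃ N₁ N₀, ∃ α ∈ T,
      HasRoots (polyOfCoeffs (m + 2) (coeffVec m N z₁ z₀ x)) α.1 α.2) :
    ((N₃ : ℝ) ^ m * N * N₁ * N₀) / 6000 ≤ ((algebraicPoints (m + 2) Q ∩ T).ncard : ℝ) := by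
  classical
  set S := familyIndex m N N₃ N₁ N₀ with hS
  set P := fun x => polyOfCoeffs (m + 2) (coeffVec m N z₁ z₀ x) with hP
  have hroots' : ∀ x, ∃ α : ℝ × ℝ, x ∈ S → α ∈ T ∧ HasRoots (P x) α.1 α.2 := by
    intro x
    by_cases hx : x ∈ S
    · obtain ⟨α, h1, h2⟩ := hroots x hx
      exact ⟨α, fun _ => ⟨h1, h2⟩⟩
    · exact ⟨0, fun h => absurd h hx⟩
  choose α hα using hroots'
  have hcoef : ∀ x, ∀ j ≤ m + 2, (((P x).content.natAbs : ℕ) : ℤ) ∣ coeffVec m N z₁ z₀ x j := by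
    intro x j hj
    have h := content_dvd_coeff (p := P x) j
    simp only [hP, coeff_polyOfCoeffs, if_pos hj] at h
    exact Int.natAbs_dvd.2 h
  have hhalf := half_le_card_filter (Fintype.piFinset fun _ : Fin m => Finset.range N₃) hN₁ hN₀ hN
    (le_refl 3000) (fun _ => 4 * (N : ℤ) + if m = 0 then 1 else 0) (fun x => 4 * z₁ x)
    (fun x => 4 * z₀ x + 2) (fun x => (P x).content.natAbs) S rfl (fun x hx => by
      have h2 := hcoef x 2 (by omega)
      refine ⟨?_, h2, hcoef x 1 (by omega), hcoef x 0 (by omega)⟩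
      have hx2 := (mem_familyIndex.1 hx).2.1
      -- The content divides the coefficient of X ^ 2, which is positive and at most 9N.
      have hlt := Int.le_of_dvd (by simp only [coeffVec, upperCoeffs]; split_ifs <;> omega) h2
      simp only [coeffVec, upperCoeffs] at hlt
      split_ifs at hlt <;> omega)
  set F := S.filter fun x => (P x).content.natAbs ≤ 3000 with hF
  have himg : ((F.image α : Finset (ℝ × ℝ)) : Set (ℝ × ℝ)) ⊆ algebraicPoints (m + 2) Q ∩ T := by
    intro a ha
    obtain ⟨x, hx, rfl⟩ := Finset.mem_image.1 (Finset.mem_coe.1 ha)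
    have hxS := (Finset.mem_filter.1 hx).1
    obtain ⟨h1, h2, h3⟩ := hα x hxS
    exact ⟨mem_algebraicPoints_of_isEisensteinAt (isEisensteinAt_coeffVec x)
      (by rw [natDegree_coeffVec]; omega) (natDegree_coeffVec x).le (hQ x hxS) h2 h3, h1⟩
  have hfib : ∀ b ∈ F.image α, (F.filter fun a => α a = b).card ≤ 3000 := by
    intro b _
    -- Among polynomials with the same chosen point, the content determines the polynomial.
    have : (F.filter fun a => α a = b).card ≤ (Finset.Icc 1 3000).card := by
      refine Finset.card_le_card_of_injOn (fun x => (P x).content.natAbs) ?_ ?_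
      · intro x hx
        have h1 := (Finset.mem_filter.1 (Finset.mem_filter.1 (Finset.mem_coe.1 hx)).1).2
        refine Finset.mem_coe.2 (Finset.mem_Icc.2 ⟨?_, h1⟩)
        refine Int.natAbs_pos.2 fun h0 => ?_
        exact not_two_dvd_content (isEisensteinAt_coeffVec x) (h0 ▸ dvd_zero _)
      · intro x hx y hy hxy
        obtain ⟨hx1, hx2⟩ := Finset.mem_filter.1 (Finset.mem_coe.1 hx)
        obtain ⟨hy1, hy2⟩ := Finset.mem_filter.1 (Finset.mem_coe.1 hy)
        have hxr := (hα x (Finset.mem_filter.1 hx1).1).2.1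
        have hyr := (hα y (Finset.mem_filter.1 hy1).1).2.1
        rw [hx2] at hxr
        rw [hy2] at hyr
        refine polyOfCoeffs_coeffVec_injective (eq_of_common_root (isEisensteinAt_coeffVec x)
          (isEisensteinAt_coeffVec y) (by rw [natDegree_coeffVec]; omega)
          (by rw [natDegree_coeffVec]; omega) (leadingCoeff_coeffVec_pos x)
          (leadingCoeff_coeffVec_pos y) ?_ hxr hyr)
        exact (Int.natAbs_inj_of_nonneg_of_nonneg (content_coeffVec_nonneg x)
          (content_coeffVec_nonneg y)).1 hxy
    simpa using this
  have h1 : (F.card : ℝ) ≤ 3000 * (F.image α).card := by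
    exact_mod_cast Finset.card_le_mul_card_image F 3000 hfib
  have h2 : ((F.image α).card : ℝ) ≤ (algebraicPoints (m + 2) Q ∩ T).ncard := by
    rw [← Set.ncard_coe_finset]
    exact_mod_cast Set.ncard_le_ncard himg ((finite_algebraicPoints _ _).inter_of_left _)
  simp only [Fintype.card_piFinset, Finset.card_range, Finset.prod_const, Finset.card_univ,
    Fintype.card_fin, Nat.cast_pow] at hhalf
  linarith

end Family

/-! ### Sizes of the coefficients and shape of the family. -/

theorem upperCoeffs_bounds {m N N₃ q : ℕ} (hq : 0 < q) (hN₃ : q * N₃ ≤ N) {x : (Fin m → ℕ) × ℕ}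
    (hx₁ : ∀ j, x.1 j < N₃) (hx₂ : x.2 < N) :
    4 * (N : ℝ) ≤ upperCoeffs m N x 0 ∧ (∀ j, |(upperCoeffs m N x j : ℝ)| ≤ 9 * N) ∧
      ∀ j, |(upperCoeffs m N x (j + 1) : ℝ)| ≤ 4 * N / q := by
  have hqR : (0 : ℝ) < q := Nat.cast_pos.2 hq
  have hup : ∀ j, |(upperCoeffs m N x (j + 1) : ℝ)| ≤ 4 * N / q := by
    intro j
    have h1 : |upperCoeffs m N x (j + 1)| ≤ 4 * N₃ := by
      simp only [upperCoeffs]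
      split_ifs with h h'
      · have := hx₁ ⟨j, h⟩
        rw [abs_le]; omega
      · have := hx₁ ⟨j, h⟩
        rw [abs_le]; omega
      · simp
    have h2 : |(upperCoeffs m N x (j + 1) : ℝ)| ≤ 4 * N₃ := by exact_mod_cast h1
    have h3 : (q : ℝ) * N₃ ≤ N := by exact_mod_cast hN₃
    rw [le_div_iff₀ hqR]
    nlinarith
  have h0 : 4 * (N : ℤ) ≤ upperCoeffs m N x 0 ∧ upperCoeffs m N x 0 ≤ 9 * N := by
    simp only [upperCoeffs]
    split_ifs <;> omega
  have h0' : 4 * (N : ℝ) ≤ upperCoeffs m N x 0 := by exact_mod_cast h0.1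
  refine ⟨h0', fun j => ?_, hup⟩
  cases j with
  | zero =>
    have h1 : (upperCoeffs m N x 0 : ℝ) ≤ 9 * N := by exact_mod_cast h0.2
    rw [abs_le]
    constructor <;> linarith [Nat.cast_nonneg (α := ℝ) N]
  | succ j =>
    refine (hup j).trans ?_
    have hN0 : (0 : ℝ) ≤ N := Nat.cast_nonneg _
    have : (1 : ℝ) ≤ q := by exact_mod_cast hq
    exact (div_le_self (by linarith) this).trans (by linarith)

theorem abs_floor_shift_le (w : ℝ) {t M : ℕ} (ht : t < M) :
    |4 * (t : ℝ) + (4 * (⌊-w / 4⌋ : ℝ) + w)| ≤ 4 * M := by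
  have h1 := Int.floor_le (-w / 4)
  have h2 := Int.lt_floor_add_one (-w / 4)
  have h3 : (t : ℝ) + 1 ≤ M := by exact_mod_cast ht
  have h4 : (0 : ℝ) ≤ t := Nat.cast_nonneg _
  rw [abs_le]
  constructor <;> linarith

/-- Reducing each power modulo (y - d₁)(y - d₂) splits P into a multiple of that product and a
linear remainder, and the integer shifts round the remainder to multiples of 4. The coefficient of X
^ 2 dominates the higher ones, which keeps G large. -/
theorem exists_family (m : ℕ) (d₁ d₂ : ℝ) :
    ∃ (q : ℕ) (H : ℝ), 0 < q ∧ 0 < H ∧ ∀ N N₃ N₁ N₀ : ℕ, q * N₃ ≤ N → N₁ ≤ N → N₀ ≤ N →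
      ∃ (z₁ : (Fin m → ℕ) × ℕ → ℤ) (z₀ : ((Fin m → ℕ) × ℕ) × ℕ → ℤ),
        ∀ x ∈ familyIndex m N N₃ N₁ N₀,
          (polyHeight (polyOfCoeffs (m + 2) (coeffVec m N z₁ z₀ x)) : ℝ) ≤ H * N ∧
          ∃ (G : ℝ → ℝ) (B E : ℝ), (∀ y, |y - d₁| ≤ 2 * |d₁ - d₂| → 2 * (N : ℝ) ≤ G y) ∧
            |B| ≤ 4 * N₁ ∧ |E| ≤ 4 * N₀ ∧
            ∀ y : ℝ, aeval y (polyOfCoeffs (m + 2) (coeffVec m N z₁ z₀ x)) =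
              (y - d₁) * (y - d₂) * G y + E + B * (y - d₁) := by
  obtain ⟨g, u, v, hg, hg0, hpow⟩ := exists_pow_interpolation d₁ d₂
  have hbd : ∀ j, ∃ M : ℝ, ∀ y, |y - d₁| ≤ 2 * |d₁ - d₂| → |g j y| ≤ M := by
    intro j
    obtain ⟨M, hM⟩ := (isCompact_closedBall d₁ (2 * |d₁ - d₂|)).exists_bound_of_continuousOn
      (hg j).continuousOn
    exact ⟨M, fun y hy => hM y (by rwa [Metric.mem_closedBall, Real.dist_eq])⟩
  choose M hM using hbd
  -- With higher coefficients at most 4N/q, their part of G is at most 2N, against at least 4N from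
  -- the coefficient of X ^ 2.
  obtain ⟨q, hq⟩ := exists_nat_gt (max 0 (2 * ∑ j ∈ Finset.range m, M (j + 1)))
  have hqR : (0 : ℝ) < q := (le_max_left _ _).trans_lt hq
  have hqM : 2 * ∑ j ∈ Finset.range m, M (j + 1) ≤ q := ((le_max_right _ _).trans_lt hq).le
  have hq0 : 0 < q := by exact_mod_cast hqR
  set Lu := ∑ j ∈ Finset.range (m + 1), |u j| with hLu
  set Lv := ∑ j ∈ Finset.range (m + 1), |v j| with hLv
  have hLu0 : 0 ≤ Lu := Finset.sum_nonneg fun _ _ => abs_nonneg _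
  have hLv0 : 0 ≤ Lv := Finset.sum_nonneg fun _ _ => abs_nonneg _
  refine ⟨q, 13 + 9 * Lu + 9 * Lv + 4 * |d₁|, hq0, by positivity, ?_⟩
  intro N N₃ N₁ N₀ hN₃ hN₁ hN₀
  set U : (Fin m → ℕ) × ℕ → ℝ :=
    fun x => ∑ j ∈ Finset.range (m + 1), (upperCoeffs m N x j : ℝ) * u j with hU
  set V : (Fin m → ℕ) × ℕ → ℝ :=
    fun x => ∑ j ∈ Finset.range (m + 1), (upperCoeffs m N x j : ℝ) * v j with hV
  set z₁ : (Fin m → ℕ) × ℕ → ℤ := fun x => ⌊-V x / 4⌋ with hz₁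
  set β : ((Fin m → ℕ) × ℕ) × ℕ → ℝ := fun x => 4 * (x.2 : ℝ) + (4 * (z₁ x.1 : ℝ) + V x.1) with hβ
  -- The remainder is written in powers of y - d₁, so its constant term also receives β d₁; the 2 is
  -- the residue modulo 4 of the constant coefficient.
  set z₀ : ((Fin m → ℕ) × ℕ) × ℕ → ℤ := fun x => ⌊-(U x.1 + β x * d₁ + 2) / 4⌋ with hz₀
  refine ⟨z₁, z₀, fun x hx => ?_⟩
  obtain ⟨hx₁, hx₂, hxB, hxE⟩ := mem_familyIndex.1 hx
  obtain ⟨hlow, hall, hup⟩ := upperCoeffs_bounds hq0 hN₃ hx₁ hx₂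
  have hN0 : (0 : ℝ) ≤ N := Nat.cast_nonneg _
  have hB : |β x.1| ≤ 4 * N₁ := abs_floor_shift_le _ hxB
  set E : ℝ := 4 * (x.2 : ℝ) + (4 * (z₀ x.1 : ℝ) + (U x.1.1 + β x.1 * d₁ + 2)) with hEdef
  have hE : |E| ≤ 4 * N₀ := abs_floor_shift_le _ hxE
  have hsum : ∀ w : ℕ → ℝ, |∑ j ∈ Finset.range (m + 1), (upperCoeffs m N x.1.1 j : ℝ) * w j|
      ≤ 9 * N * ∑ j ∈ Finset.range (m + 1), |w j| := by
    intro w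
    refine (Finset.abs_sum_le_sum_abs _ _).trans ?_
    rw [Finset.mul_sum]
    refine Finset.sum_le_sum fun j _ => ?_
    rw [abs_mul]
    exact mul_le_mul_of_nonneg_right (hall j) (abs_nonneg _)
  have hUx : |U x.1.1| ≤ 9 * N * Lu := hsum u
  have hVx : |V x.1.1| ≤ 9 * N * Lv := hsum v
  have hN₁' : (N₁ : ℝ) ≤ N := Nat.cast_le.2 hN₁
  have hN₀' : (N₀ : ℝ) ≤ N := Nat.cast_le.2 hN₀
  have ha1 : (coeffVec m N z₁ z₀ x 1 : ℝ) = β x.1 - V x.1.1 := by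
    simp only [coeffVec, hβ]; push_cast; ring
  have ha0 : (coeffVec m N z₁ z₀ x 0 : ℝ) = E - U x.1.1 - β x.1 * d₁ := by
    simp only [coeffVec, hEdef]; push_cast; ring
  have hd0 := abs_nonneg d₁
  have hNd : 0 ≤ (N : ℝ) * |d₁| := mul_nonneg hN0 hd0
  have hNLu : 0 ≤ (N : ℝ) * Lu := mul_nonneg hN0 hLu0
  have hNLv : 0 ≤ (N : ℝ) * Lv := mul_nonneg hN0 hLv0
  refine ⟨?_, fun y => ∑ j ∈ Finset.range (m + 1), (upperCoeffs m N x.1.1 j : ℝ) * g j y,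
    β x.1, E, ?_, hB, hE, ?_⟩
  · have hcoef : ∀ j ≤ m + 2, |(coeffVec m N z₁ z₀ x j : ℝ)|
        ≤ (13 + 9 * Lu + 9 * Lv + 4 * |d₁|) * N := by
      intro j _
      match j with
      | 0 =>
        rw [ha0]
        have h1 : |E - U x.1.1 - β x.1 * d₁| ≤ |E| + |U x.1.1| + |β x.1| * |d₁| := by
          rw [← abs_mul]
          exact (abs_sub _ _).trans (add_le_add_left (abs_sub _ _) _)
        have h2 : |β x.1| * |d₁| ≤ 4 * N * |d₁| :=
          mul_le_mul_of_nonneg_right (by linarith) hd0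
        linarith
      | 1 =>
        rw [ha1]
        have h1 := abs_sub (β x.1) (V x.1.1)
        linarith
      | j + 2 =>
        have := hall j
        simp only [coeffVec]
        linarith
    have hheight : polyHeight (polyOfCoeffs (m + 2) (coeffVec m N z₁ z₀ x))
        ≤ ⌊(13 + 9 * Lu + 9 * Lv + 4 * |d₁|) * N⌋₊ := by
      refine polyHeight_le_iff.2 fun j => ?_
      rw [coeff_polyOfCoeffs]
      split_ifs with hj
      · refine Nat.le_floor ?_
        rw [Nat.cast_natAbs]
        exact_mod_cast hcoef j hj
      · simp
    exact (Nat.cast_le.2 hheight).trans (Nat.floor_le (by positivity))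
  · intro y hy
    simp only
    rw [Finset.sum_range_succ', hg0, mul_one]
    have h1 : |∑ j ∈ Finset.range m, (upperCoeffs m N x.1.1 (j + 1) : ℝ) * g (j + 1) y|
        ≤ 4 * N / q * ∑ j ∈ Finset.range m, M (j + 1) := by
      refine (Finset.abs_sum_le_sum_abs _ _).trans ?_
      rw [Finset.mul_sum]
      refine Finset.sum_le_sum fun j _ => ?_
      rw [abs_mul]
      exact mul_le_mul (hup j) (hM _ y hy) (abs_nonneg _) (by positivity)
    have h2 : 4 * (N : ℝ) / q * ∑ j ∈ Finset.range m, M (j + 1) ≤ 2 * N := by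
      rw [div_mul_eq_mul_div, div_le_iff₀ hqR]
      nlinarith
    have h3 := (abs_le.1 (h1.trans h2)).1
    linarith
  · intro y
    rw [aeval_polyOfCoeffs, Finset.sum_range_succ', Finset.sum_range_succ']
    have h1 : ∀ j ∈ Finset.range (m + 1), (coeffVec m N z₁ z₀ x (j + 1 + 1) : ℝ) * y ^ (j + 1 + 1)
        = (y - d₁) * (y - d₂) * ((upperCoeffs m N x.1.1 j : ℝ) * g j y)
          + (upperCoeffs m N x.1.1 j : ℝ) * u j + (upperCoeffs m N x.1.1 j : ℝ) * v j * y := by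
      intro j _
      rw [show y ^ (j + 1 + 1) = _ from hpow j y]
      simp only [coeffVec]
      ring
    rw [Finset.sum_congr rfl h1, Finset.sum_add_distrib, Finset.sum_add_distrib, ← Finset.mul_sum,
      ← Finset.sum_mul]
    simp only [zero_add, pow_one, pow_zero, mul_one]
    rw [ha1, ha0]
    simp only [hU, hV]
    ring

theorem half_le_natFloor {x : ℝ} (hx : 1 ≤ x) : x / 2 ≤ ⌊x⌋₊ ∧ 0 < ⌊x⌋₊ := by
  have h1 := Nat.lt_floor_add_one x
  have h2 : 0 < ⌊x⌋₊ := Nat.floor_pos.2 hx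
  have h3 : (1 : ℝ) ≤ ⌊x⌋₊ := by exact_mod_cast h2
  exact ⟨by linarith, h2⟩

/-! ### Choice of parameters and the lower bound for open rectangles. -/

theorem exists_le_ncard_algebraicPoints_of_le (m : ℕ) {d₁ d₂ : ℝ} (hd : d₁ ≠ d₂) :
    ∃ c₀ : ℝ, 0 < c₀ ∧ ∃ c₂ : ℝ, 0 < c₂ ∧ ∀ Q r₁ r₂ : ℝ, 0 < Q → 0 < r₁ → r₁ ≤ r₂ →
      r₂ ≤ |d₁ - d₂| → c₀ ≤ Q * (r₁ * r₂) →
      c₂ * Q ^ (m + 3) * (r₁ * r₂) ≤ ((algebraicPoints (m + 2) Q ∩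
        Set.Ioo (d₁ - r₁) (d₁ + r₁) ×ˢ Set.Ioo (d₂ - r₂) (d₂ + r₂)).ncard : ℝ) := by
  obtain ⟨q, H, hq, hH, hfam⟩ := exists_family m d₁ d₂
  have hqR : (0 : ℝ) < q := Nat.cast_pos.2 hq
  set D := |d₁ - d₂| with hD
  have hD0 : 0 < D := abs_pos.2 (sub_ne_zero.2 hd)
  -- The first entry makes B and E small enough for `exists_roots_near`; the second gives N₀, N₁ ≤
  -- N.
  set c := min (D / (32 * (1 + 2 * D))) D⁻¹ with hc
  have hc0 : 0 < c := lt_min (by positivity) (by positivity)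
  have hc1 : c * D ≤ 1 := by
    rw [← le_div_iff₀ hD0, one_div]; exact min_le_right _ _
  have hc2 : (1 + 2 * D) * (4 * c) ≤ D / 8 := by
    have h := min_le_left (D / (32 * (1 + 2 * D))) D⁻¹
    rw [← hc, le_div_iff₀ (by positivity)] at h
    linarith
  -- The three summands give, in order, Q ≥ qH, c N r₁ ≥ 1 and N ≤ N₀N₁. In the second constant,
  -- 24000 is 6000 times the 4 lost in rounding down N₀ and N₁.
  refine ⟨q * H * (D * D) + 2 * H * D / c + 8 * H / c ^ 2, by positivity,
    (1 / (2 * H)) ^ (m + 3) * (1 / (2 * q)) ^ m * c ^ 2 / 24000, by positivity, ?_⟩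
  intro Q r₁ r₂ hQ hr₁ hr hr₂ hc₀
  have hr₂0 : 0 < r₂ := hr₁.trans_le hr
  have t1 : 0 < (q : ℝ) * H * (D * D) := by positivity
  have t2 : 0 < 2 * H * D / c := by positivity
  have t3 : 0 < 8 * H / c ^ 2 := by positivity
  -- `Q` is large
  have hQq : (q : ℝ) ≤ Q / H := by
    rw [le_div_iff₀ hH]
    have h1 : Q * (r₁ * r₂) ≤ Q * (D * D) := by gcongr; exact hr.trans hr₂
    have h2 : (q : ℝ) * H * (D * D) ≤ Q * (D * D) := by linarith
    exact le_of_mul_le_mul_right h2 (by positivity)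
  have hq1 : (1 : ℝ) ≤ q := by exact_mod_cast hq
  obtain ⟨hNlow, hN0⟩ := half_le_natFloor (hq1.trans hQq)
  have hNq : q ≤ ⌊Q / H⌋₊ := Nat.le_floor hQq
  have hNhigh : (⌊Q / H⌋₊ : ℝ) ≤ Q / H := Nat.floor_le (by positivity)
  set N := ⌊Q / H⌋₊ with hN
  have hNR : (0 : ℝ) < N := Nat.cast_pos.2 hN0
  have hNlow' : 1 / (2 * H) * Q ≤ N := by
    have : 1 / (2 * H) * Q = Q / H / 2 := by field_simp
    rw [this]; exact hNlow
  -- the side lengths are large compared with `Q⁻¹`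
  have hx₀ : 1 ≤ c * N * r₁ := by
    have h1 : Q * (r₁ * r₂) ≤ Q * r₁ * D := by
      rw [← mul_assoc]; gcongr
    have h2 : 2 * H * D / c ≤ Q * r₁ * D := by linarith
    rw [div_le_iff₀ hc0] at h2
    have h3 : 2 * H ≤ c * (Q * r₁) := le_of_mul_le_mul_right (by linarith) hD0
    have h4 : c * (1 / (2 * H) * Q) * r₁ ≤ c * N * r₁ := by gcongr
    refine le_trans ?_ h4
    have h5 : c * (1 / (2 * H) * Q) * r₁ = c * (Q * r₁) / (2 * H) := by field_simp
    rw [h5, le_div_iff₀ (by positivity)]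
    linarith
  have hx₁ : 1 ≤ c * N * r₂ := hx₀.trans (by gcongr)
  obtain ⟨hN₀low, hN₀0⟩ := half_le_natFloor hx₀
  obtain ⟨hN₁low, hN₁0⟩ := half_le_natFloor hx₁
  have hN₀high : (⌊c * N * r₁⌋₊ : ℝ) ≤ c * N * r₁ := Nat.floor_le (by positivity)
  have hN₁high : (⌊c * N * r₂⌋₊ : ℝ) ≤ c * N * r₂ := Nat.floor_le (by positivity)
  set N₀ := ⌊c * N * r₁⌋₊ with hN₀
  set N₁ := ⌊c * N * r₂⌋₊ with hN₁
  have hcN : c * N * r₂ ≤ N := by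
    have : c * r₂ ≤ 1 := (mul_le_mul_of_nonneg_left hr₂ hc0.le).trans hc1
    calc c * N * r₂ = N * (c * r₂) := by ring
      _ ≤ N * 1 := by gcongr
      _ = N := mul_one _
  have hN₁N : N₁ ≤ N := by exact_mod_cast hN₁high.trans hcN
  have hN₀N : N₀ ≤ N := by
    have : c * N * r₁ ≤ c * N * r₂ := by gcongr
    exact_mod_cast hN₀high.trans (this.trans hcN)
  have hprod : c ^ 2 * (N : ℝ) ^ 2 * (r₁ * r₂) / 4 ≤ (N₁ : ℝ) * N₀ := by
    calc c ^ 2 * (N : ℝ) ^ 2 * (r₁ * r₂) / 4 = (c * N * r₂ / 2) * (c * N * r₁ / 2) := by ring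
      _ ≤ (N₁ : ℝ) * N₀ := by gcongr
  have hNN : N ≤ N₀ * N₁ := by
    have h1 : 8 * H / c ^ 2 ≤ Q * (r₁ * r₂) := by linarith
    rw [div_le_iff₀ (by positivity)] at h1
    have h2 : c ^ 2 * (N * (1 / (2 * H) * Q)) * (r₁ * r₂) / 4
        ≤ c ^ 2 * (N : ℝ) ^ 2 * (r₁ * r₂) / 4 := by
      rw [sq (N : ℝ)]; gcongr
    have h3 : c ^ 2 * (N * (1 / (2 * H) * Q)) * (r₁ * r₂) / 4
        = N * (Q * (r₁ * r₂) * c ^ 2) / (8 * H) := by field_simp; ring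
    have h4 : (N : ℝ) ≤ N * (Q * (r₁ * r₂) * c ^ 2) / (8 * H) := by
      rw [le_div_iff₀ (by positivity)]
      exact mul_le_mul_of_nonneg_left h1 hNR.le
    have h5 : (N : ℝ) ≤ N₀ * N₁ := by linarith
    exact_mod_cast h5
  set N₃ := N / q with hN₃
  have hN₃low : 1 / (2 * q) * (N : ℝ) ≤ N₃ := by
    have h1 : N < q * N₃ + q := by
      rw [hN₃, ← Nat.mul_succ]; exact Nat.lt_mul_div_succ N hq
    have h2 : 1 ≤ N₃ := (Nat.one_le_div_iff hq).2 hNq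
    have h3 : (N : ℝ) ≤ q * N₃ + q := by exact_mod_cast h1.le
    have h4 : (1 : ℝ) ≤ N₃ := by exact_mod_cast h2
    rw [one_div_mul_eq_div, div_le_iff₀ (by positivity)]
    nlinarith
  obtain ⟨z₁, z₀, hz⟩ := hfam N N₃ N₁ N₀ (Nat.mul_div_le N q) hN₁N hN₀N
  refine le_trans ?_ (card_le_ncard_algebraicPoints (m := m) (N := N) (z₁ := z₁) (z₀ := z₀)
    (N₃ := N₃) hN₁0 hN₀0 hNN hN0 (fun x hx => ?_) (fun x hx => ?_))
  · have hpow1 : (1 / (2 * H)) ^ (m + 3) * Q ^ (m + 3) ≤ (N : ℝ) ^ (m + 3) := by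
      rw [← mul_pow]; gcongr
    have hpow2 : (1 / (2 * (q : ℝ))) ^ m * (N : ℝ) ^ m ≤ (N₃ : ℝ) ^ m := by
      rw [← mul_pow]; gcongr
    calc (1 / (2 * H)) ^ (m + 3) * (1 / (2 * (q : ℝ))) ^ m * c ^ 2 / 24000 * Q ^ (m + 3)
          * (r₁ * r₂)
        = ((1 / (2 * H)) ^ (m + 3) * Q ^ (m + 3)) * ((1 / (2 * (q : ℝ))) ^ m * c ^ 2 / 24000
          * (r₁ * r₂)) := by ring
      _ ≤ (N : ℝ) ^ (m + 3) * ((1 / (2 * (q : ℝ))) ^ m * c ^ 2 / 24000 * (r₁ * r₂)) := by gcongr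
      _ = ((1 / (2 * (q : ℝ))) ^ m * (N : ℝ) ^ m) * N * (c ^ 2 * (N : ℝ) ^ 2 * (r₁ * r₂) / 4)
          / 6000 := by ring
      _ ≤ (N₃ : ℝ) ^ m * N * (N₁ * N₀) / 6000 := by gcongr
      _ = (N₃ : ℝ) ^ m * N * N₁ * N₀ / 6000 := by ring
  · refine (hz x hx).1.trans ?_
    rw [le_div_iff₀ hH] at hNhigh
    linarith
  · obtain ⟨-, G, B, E, hG, hB, hE, hP⟩ := hz x hx
    have key : ∀ {r Z : ℝ} {M : ℕ}, 0 < r → |Z| ≤ 4 * M → (M : ℝ) ≤ c * N * r →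
        (1 + 2 * D) * |Z| ≤ r * D * (2 * N) / 16 := by
      intro r Z M hr0 h1 h2
      calc (1 + 2 * D) * |Z| ≤ (1 + 2 * D) * (4 * (c * N * r)) := by gcongr; linarith
        _ = ((1 + 2 * D) * (4 * c)) * (N * r) := by ring
        _ ≤ D / 8 * (N * r) := by gcongr
        _ = r * D * (2 * N) / 16 := by ring
    obtain ⟨y₁, y₂, h1, h2, h3, h4⟩ := exists_roots_near
      (f := fun y => aeval y (polyOfCoeffs (m + 2) (coeffVec m N z₁ z₀ x)))
      (Polynomial.continuous_aeval _) hr₁ hr hr₂ (by positivity) hG hP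
      (key hr₂0 hB hN₁high) (key hr₁ hE hN₀high)
    rw [abs_lt] at h3 h4
    refine ⟨(y₁, y₂), ⟨⟨?_, ?_⟩, ⟨?_, ?_⟩⟩, h1, h2⟩ <;> linarith

theorem ncard_algebraicPoints_inter_prod_comm (n : ℕ) (Q : ℝ) (I J : Set ℝ) :
    (algebraicPoints n Q ∩ I ×ˢ J).ncard = (algebraicPoints n Q ∩ J ×ˢ I).ncard := by
  have hle : ∀ I J : Set ℝ, (algebraicPoints n Q ∩ I ×ˢ J).ncard
      ≤ (algebraicPoints n Q ∩ J ×ˢ I).ncard := fun I J =>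
    Set.ncard_le_ncard_of_injOn Prod.swap
      (fun _ h => ⟨algebraicPoints_swap h.1, h.2.2, h.2.1⟩) Prod.swap_injective.injOn
      ((finite_algebraicPoints _ _).inter_of_left _)
  exact (hle I J).antisymm (hle J I)

theorem exists_le_ncard_algebraicPoints (m : ℕ) {d₁ d₂ : ℝ} (hd : d₁ ≠ d₂) :
    ∃ c₀ : ℝ, 0 < c₀ ∧ ∃ c₂ : ℝ, 0 < c₂ ∧ ∀ Q r₁ r₂ : ℝ, 0 < Q → 0 < r₁ → 0 < r₂ →
      r₁ ≤ |d₁ - d₂| → r₂ ≤ |d₁ - d₂| → c₀ ≤ Q * (r₁ * r₂) →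
      c₂ * Q ^ (m + 3) * (r₁ * r₂) ≤ ((algebraicPoints (m + 2) Q ∩
        Set.Ioo (d₁ - r₁) (d₁ + r₁) ×ˢ Set.Ioo (d₂ - r₂) (d₂ + r₂)).ncard : ℝ) := by
  obtain ⟨a, ha, b, hb, h⟩ := exists_le_ncard_algebraicPoints_of_le m hd
  obtain ⟨a', ha', b', hb', h'⟩ := exists_le_ncard_algebraicPoints_of_le m hd.symm
  refine ⟨max a a', lt_max_of_lt_left ha, min b b', lt_min hb hb', ?_⟩
  intro Q r₁ r₂ hQ hr₁ hr₂ hD₁ hD₂ hc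
  rcases le_total r₁ r₂ with hr | hr
  · refine le_trans ?_ (h Q r₁ r₂ hQ hr₁ hr hD₂ ((le_max_left _ _).trans hc))
    gcongr
    exact min_le_left _ _
  · rw [abs_sub_comm] at hD₁
    rw [mul_comm r₁] at hc ⊢
    rw [ncard_algebraicPoints_inter_prod_comm]
    refine le_trans ?_ (h' Q r₂ r₁ hQ hr₂ hr hD₁ ((le_max_right _ _).trans hc))
    gcongr
    exact min_le_right _ _

/-! ### From half-sides to measures, and the theorem. -/

theorem volume_eq_of_Ioo_subset_subset_Icc {I : Set ℝ} {d r : ℝ}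
    (h₁ : Set.Ioo (d - r) (d + r) ⊆ I) (h₂ : I ⊆ Set.Icc (d - r) (d + r)) :
    volume I = ENNReal.ofReal (2 * r) := by
  have e : d + r - (d - r) = 2 * r := by ring
  refine le_antisymm ((measure_mono h₂).trans ?_) (le_trans ?_ (measure_mono h₁))
  · rw [Real.volume_Icc, e]
  · rw [Real.volume_Ioo, e]

/-- The midpoint of each side of a rectangle that avoids the diagonal lies outside the other
side. -/
theorem le_abs_sub_of_inter_strip_eq_empty {I₁ I₂ : Set ℝ} {d₁ d₂ r₁ r₂ ε : ℝ} (hε : 0 < ε)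
    (hr₁ : 0 < r₁) (hr₂ : 0 < r₂) (h₁ : Set.Ioo (d₁ - r₁) (d₁ + r₁) ⊆ I₁)
    (h₂ : Set.Ioo (d₂ - r₂) (d₂ + r₂) ⊆ I₂)
    (h : (I₁ ×ˢ I₂) ∩ {x : ℝ × ℝ | |x.1 - x.2| < ε} = ∅) :
    r₁ ≤ |d₁ - d₂| ∧ r₂ ≤ |d₁ - d₂| := by
  have hno : ∀ z, z ∈ I₁ → z ∈ I₂ → False := fun z hz₁ hz₂ =>
    Set.eq_empty_iff_forall_notMem.1 h (z, z) ⟨⟨hz₁, hz₂⟩, by simpa using hε⟩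
  constructor <;> by_contra! hlt <;> rw [abs_lt] at hlt
  · exact hno d₂ (h₁ ⟨by linarith, by linarith⟩) (h₂ ⟨by linarith, by linarith⟩)
  · exact hno d₁ (h₁ ⟨by linarith, by linarith⟩) (h₂ ⟨by linarith, by linarith⟩)

theorem le_mul_rpow_neg_of_lt {a κ s Q : ℝ} (ha : 0 < a) (hκ : 0 < κ) (hs : s ≤ 1)
    (hsκ : s = 1 → a ≤ κ) (hQ : max 1 ((a / κ) ^ (1 / (1 - s))) < Q) :
    a ≤ Q * (κ * Q ^ (-s)) := by
  have hQ1 : 1 < Q := (le_max_left _ _).trans_lt hQ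
  have hQ0 : 0 < Q := one_pos.trans hQ1
  have e : Q * (κ * Q ^ (-s)) = Q ^ (1 - s) * κ := by
    rw [sub_eq_add_neg, Real.rpow_add hQ0, Real.rpow_one]; ring
  rw [e]
  rcases hs.eq_or_lt with rfl | hs
  · simpa using hsκ rfl
  · have h1 : 0 < 1 - s := sub_pos.2 hs
    rw [← div_le_iff₀ hκ]
    have h2 := Real.rpow_le_rpow (by positivity) ((le_max_right _ _).trans_lt hQ).le h1.le
    rwa [← Real.rpow_mul (by positivity), one_div_mul_cancel h1.ne', Real.rpow_one] at h2

theorem theorem1 (n : ℕ) (hn : 2 ≤ n) (ε : ℝ) (hε : 0 < ε) (d₁ d₂ : ℝ) :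
    ∃ c₀ : ℝ, 0 < c₀ ∧ ∃ c₂ : ℝ, 0 < c₂ ∧
      ∀ s₁ s₂ : ℝ, s₁ < 1 → s₂ < 1 → 0 < s₁ + s₂ → s₁ + s₂ ≤ 1 →
      ∀ κ : ℝ, 0 < κ → (s₁ + s₂ = 1 → c₀ ≤ κ) →
      ∃ Q₀ : ℝ, 0 < Q₀ ∧
      ∀ c₁₁ c₁₂ : ℝ, 0 < c₁₁ → 0 < c₁₂ → κ < c₁₁ * c₁₂ →
      ∀ Q : ℝ, Q₀ < Q →
      ∀ I₁ I₂ : Set ℝ, IsIntervalWithMidpoint I₁ d₁ → IsIntervalWithMidpoint I₂ d₂ →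
        volume I₁ = ENNReal.ofReal (c₁₁ * Q ^ (-s₁)) →
        volume I₂ = ENNReal.ofReal (c₁₂ * Q ^ (-s₂)) →
        (I₁ ×ˢ I₂) ∩ {x : ℝ × ℝ | |x.1 - x.2| < ε} = ∅ →
        c₂ * Q ^ (n + 1) * (volume (I₁ ×ˢ I₂)).toReal ≤
          ((algebraicPoints n Q ∩ I₁ ×ˢ I₂).ncard : ℝ) := by
  obtain ⟨m, rfl⟩ := Nat.exists_eq_add_of_le' hn
  rcases eq_or_ne d₁ d₂ with rfl | hd
  -- A midpoint on the diagonal lies in the strip, so no rectangle qualifies and any constants do.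
  · refine ⟨1, one_pos, 1, one_pos, fun s₁ s₂ _ _ _ _ κ _ _ => ⟨1, one_pos, ?_⟩⟩
    rintro c₁₁ c₁₂ _ _ _ Q _ I₁ I₂ ⟨r₁, hr₁, h₁, _⟩ ⟨r₂, hr₂, h₂, _⟩ _ _ hempty
    have := (le_abs_sub_of_inter_strip_eq_empty hε hr₁ hr₂ h₁ h₂ hempty).1
    rw [sub_self, abs_zero] at this
    exact absurd hr₁ this.not_gt
  obtain ⟨c₀, hc₀, c₂, hc₂, key⟩ := exists_le_ncard_algebraicPoints m hd
  -- The factors 4 convert r₁r₂ into the area (2r₁)(2r₂).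
  refine ⟨4 * c₀, by positivity, c₂ / 4, by positivity, ?_⟩
  intro s₁ s₂ _ _ _ hs κ hκ hsκ
  -- For s₁ + s₂ < 1 this makes κ Q^(1 - s₁ - s₂) ≥ 4c₀. For s₁ + s₂ = 1 the exponent is 1/0 = 0, so
  -- the threshold is 1 and the bound comes from the assumption on κ.
  refine ⟨max 1 ((4 * c₀ / κ) ^ (1 / (1 - (s₁ + s₂)))), lt_max_of_lt_left one_pos, ?_⟩
  rintro c₁₁ c₁₂ hc₁₁ hc₁₂ hκc Q hQ I₁ I₂ ⟨r₁, hr₁, h₁, h₁'⟩ ⟨r₂, hr₂, h₂, h₂'⟩ hv₁ hv₂ hempty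
  have hQ0 : 0 < Q := one_pos.trans ((le_max_left _ _).trans_lt hQ)
  obtain ⟨hD₁, hD₂⟩ := le_abs_sub_of_inter_strip_eq_empty hε hr₁ hr₂ h₁ h₂ hempty
  have hvol₁ := volume_eq_of_Ioo_subset_subset_Icc h₁ h₁'
  have hvol₂ := volume_eq_of_Ioo_subset_subset_Icc h₂ h₂'
  have hp₁ : 0 < c₁₁ * Q ^ (-s₁) := mul_pos hc₁₁ (Real.rpow_pos_of_pos hQ0 _)
  have hp₂ : 0 < c₁₂ * Q ^ (-s₂) := mul_pos hc₁₂ (Real.rpow_pos_of_pos hQ0 _)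
  have e₁ : 2 * r₁ = c₁₁ * Q ^ (-s₁) :=
    (ENNReal.ofReal_eq_ofReal_iff (by positivity) hp₁.le).1 (hvol₁.symm.trans hv₁)
  have e₂ : 2 * r₂ = c₁₂ * Q ^ (-s₂) :=
    (ENNReal.ofReal_eq_ofReal_iff (by positivity) hp₂.le).1 (hvol₂.symm.trans hv₂)
  have harea : (volume (I₁ ×ˢ I₂)).toReal = 4 * (r₁ * r₂) := by
    rw [Measure.volume_eq_prod, Measure.prod_prod, hvol₁, hvol₂, ENNReal.toReal_mul,
      ENNReal.toReal_ofReal (by positivity), ENNReal.toReal_ofReal (by positivity)]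
    ring
  have hlarge : c₀ ≤ Q * (r₁ * r₂) := by
    have h1 := le_mul_rpow_neg_of_lt (by positivity : 0 < 4 * c₀) hκ hs hsκ hQ
    have h2 : κ * Q ^ (-(s₁ + s₂)) ≤ (2 * r₁) * (2 * r₂) := by
      rw [e₁, e₂, neg_add, Real.rpow_add hQ0]
      have := mul_le_mul_of_nonneg_right hκc.le
        (mul_pos (Real.rpow_pos_of_pos hQ0 (-s₁)) (Real.rpow_pos_of_pos hQ0 (-s₂))).le
      linarith
    have h3 := mul_le_mul_of_nonneg_left h2 hQ0.le
    linarith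
  have hmono : ((algebraicPoints (m + 2) Q ∩
      Set.Ioo (d₁ - r₁) (d₁ + r₁) ×ˢ Set.Ioo (d₂ - r₂) (d₂ + r₂)).ncard : ℝ) ≤
      (algebraicPoints (m + 2) Q ∩ I₁ ×ˢ I₂).ncard := by
    exact_mod_cast Set.ncard_le_ncard
      (Set.inter_subset_inter_right _ (Set.prod_mono h₁ h₂))
      ((finite_algebraicPoints _ _).inter_of_left _)
  refine le_trans (le_of_eq ?_) ((key Q r₁ r₂ hQ0 hr₁ hr₂ hD₁ hD₂ hlarge).trans hmono)
  rw [harea]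
  ring
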